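/- Let $\omega=\frac{-1+\sqrt{3}\,i}{2}$ and, for $z\in\mathbb{C}$ with $|z|<1$, let $$F(a,b,c;z)=\sum_{n=0}^\infty \frac{(a)_n (b)_n}{(c)_n\, n!}\,z^n,\qquad (a)_n=a(a+1)\cdots(a+n-1),$$ be the Gauss hypergeometric series. Then there is a neighborhood of $z=0$ in $\mathbb{C}$ on which the following four functional equations hold: $$F\Big(\tfrac16,\tfrac12,1;\tfrac{3\sqrt3\, i\, z(1-z)}{(1+\omega z)^3}\Big)^2=-\omega^2F\big(\tfrac12,\tfrac12,1;z\big)^2-\omega F\Big(\tfrac12,\tfrac12,1;\tfrac{z}{z-1}\Big)^2,$$ $$F\Big(\tfrac16,\tfrac12,1;-\tfrac{3\sqrt3\, i\, z(1-z)}{(z+\omega)^3}\Big)^2=-\omega F\big(\tfrac12,\tfrac12,1;z\big)^2-\omega^2 F\Big(\tfrac12,\tfrac12,1;\tfrac{z}{z-1}\Big)^2,$$ $$F\Big(\tfrac1{12},\tfrac5{12},1;\tfrac{z^2}{4(z-1)}\Big)^2=F\big(\tfrac16,\tfrac12,1;z\big)\,F\Big(\tfrac16,\tfrac12,1;\tfrac{z}{z-1}\Big),$$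 $$F\Big(\tfrac1{12},\tfrac5{12},1;\tfrac{27z^2(1-z)^2}{4(z^2-z+1)^3}\Big)^4=F\big(\tfrac12,\tfrac12,1;z\big)^4+F\Big(\tfrac12,\tfrac12,1;\tfrac{z}{z-1}\Big)^4-F\big(\tfrac12,\tfrac12,1;z\big)^2F\Big(\tfrac12,\tfrac12,1;\tfrac{z}{z-1}\Big)^2.$$ -/

import Mathlib

/-- The primitive cube root of unity `ω = (-1 + √3 i) / 2`. -/
noncomputable def omegaCube : ℂ := (-1 + (Real.sqrt 3 : ℂ) * Complex.I) / 2

/-- The Gauss hypergeometric series `F(a, b, c; z) = ∑ₙ (a)ₙ (b)ₙ / ((c)ₙ n!) zⁿ` of complex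
parameters and variable, as Mathlib's `₂F₁`. -/
noncomputable abbrev hypF (a b c z : ℂ) : ℂ := ordinaryHypergeometric a b c z

open Filter Topology

/-! At the origin the hypergeometric equation with c = 1 has the double exponent 0, so its second
solution is logarithmic and an analytic solution is determined by its value at 0. Hence h(z)
F(a,b,1;φ(z)) = F(A,B,1;z) follows from rational identities between the coefficients of the two
equations (`hypergeometric_pullback`). This yields Pfaff's transformation, a quadratic one and a
cubic one.

Write F for F(1/2,1/2,1;z) and ω for the cube root of unity. After squaring, the cubic
transformation for ω and ω² gives (1+ωz)F² and (1+ω²z)F², while Pfaff gives (1-z)F²; the first two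
equations are then linear relations from ω²+ω+1 = 0. The third combines the quadratic transformation
with Pfaff. The fourth is the third evaluated at the cubic argument. -/

/-! ### Power series and the hypergeometric equation -/

lemma HasFPowerSeriesOnBall.exists_deriv {f : ℂ → ℂ} {p : FormalMultilinearSeries ℂ ℂ ℂ} {x : ℂ}
    {r : ENNReal} (hf : HasFPowerSeriesOnBall f p x r) :
    ∃ q : FormalMultilinearSeries ℂ ℂ ℂ, HasFPowerSeriesOnBall (deriv f) q x r ∧
      ∀ n, q.coeff n = (n + 1) * p.coeff (n + 1) := by
  refine ⟨_, (ContinuousLinearMap.apply ℂ ℂ (1 : ℂ)).comp_hasFPowerSeriesOnBall hf.fderiv,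
    fun n => ?_⟩
  have := p.derivSeries_coeff_one n
  rw [nsmul_eq_mul] at this
  push_cast at this
  rw [← this]
  rfl

lemma HasFPowerSeriesOnBall.hasSum_coeff_zero {f : ℂ → ℂ} {p : FormalMultilinearSeries ℂ ℂ ℂ}
    {r : ENNReal} (hf : HasFPowerSeriesOnBall f p 0 r) {z : ℂ} (hz : z ∈ Metric.eball (0 : ℂ) r) :
    HasSum (fun n => p.coeff n * z ^ n) (f z) := by
  have := hf.hasSum hz
  rw [zero_add] at this
  refine this.congr_fun fun n => ?_
  rw [FormalMultilinearSeries.apply_eq_pow_smul_coeff, smul_eq_mul, mul_comm]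

/-- Multiplication by z shifts coefficients; this writes z f', z f'' and z² f'' in the same powers
as f, so that the equation can be compared term by term. -/
lemma HasSum.mul_shift {g g' : ℕ → ℂ} {z S : ℂ} (hg : HasSum g S) (h0 : g' 0 = 0)
    (hs : ∀ n, g' (n + 1) = z * g n) : HasSum g' (z * S) := by
  have := hg.mul_left z
  simp_rw [← hs] at this
  simpa [h0] using (hasSum_nat_add_iff 1).1 this

lemma hasFPowerSeriesOnBall_hypergeometric {a b : ℂ}
    (hab : ∀ k : ℕ, (k : ℂ) ≠ -a ∧ (k : ℂ) ≠ -b) :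
    HasFPowerSeriesOnBall (ordinaryHypergeometric a b 1 : ℂ → ℂ)
      (ordinaryHypergeometricSeries ℂ a b 1) 0 1 := by
  have hr : (ordinaryHypergeometricSeries ℂ a b (1 : ℂ)).radius = 1 := by
    refine ordinaryHypergeometricSeries_radius_eq_one ℂ a b 1 fun k =>
      ⟨(hab k).1, (hab k).2, fun h => ?_⟩
    have := congrArg Complex.re h
    simp at this
    have h0 : (0 : ℝ) ≤ k := k.cast_nonneg
    linarith
  have := (ordinaryHypergeometricSeries ℂ a b (1 : ℂ)).hasFPowerSeriesOnBall (by rw [hr]; simp)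
  rwa [hr] at this

lemma ordinaryHypergeometricCoefficient_succ (a b : ℂ) (n : ℕ) :
    ((n : ℂ) + 1) ^ 2 * ordinaryHypergeometricCoefficient a b 1 (n + 1)
      = (a + n) * (b + n) * ordinaryHypergeometricCoefficient a b 1 n := by
  have h1 : ((n : ℂ) + 1) ≠ 0 := by exact_mod_cast n.succ_ne_zero
  have h2 : ((n.factorial : ℕ) : ℂ) ≠ 0 := by exact_mod_cast n.factorial_ne_zero
  simp only [ordinaryHypergeometricCoefficient, ascPochhammer_succ_eval, Nat.factorial_succ,
    ascPochhammer_eval_one]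
  push_cast
  rw [add_comm (1 : ℂ) n]
  field_simp

/-- The Gauss hypergeometric differential equation for `c = 1`. -/
lemma hypergeometric_ode {a b : ℂ} (hab : ∀ k : ℕ, (k : ℂ) ≠ -a ∧ (k : ℂ) ≠ -b)
    {z : ℂ} (hz : z ∈ Metric.eball (0 : ℂ) 1) {F : ℂ → ℂ} (hF : F = ordinaryHypergeometric a b 1) :
    z * (1 - z) * deriv (deriv F) z + (1 - (a + b + 1) * z) * deriv F z - a * b * F z = 0 := by
  have h0 := hasFPowerSeriesOnBall_hypergeometric hab
  rw [← hF] at h0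
  obtain ⟨q, h1, hq⟩ := h0.exists_deriv
  obtain ⟨t, h2, ht⟩ := h1.exists_deriv
  have hp : ∀ n, (ordinaryHypergeometricSeries ℂ a b (1 : ℂ)).coeff n
      = ordinaryHypergeometricCoefficient a b 1 n := fun n =>
    FormalMultilinearSeries.coeff_ofScalars
  set c : ℕ → ℂ := ordinaryHypergeometricCoefficient a b 1 with hc
  have s0 := h0.hasSum_coeff_zero hz
  have s1 := h1.hasSum_coeff_zero hz
  have s2 := h2.hasSum_coeff_zero hz
  simp only [hp, hq, ht] at s0 s1 s2
  have s3 : HasSum (fun n : ℕ => n * c n * z ^ n) (z * deriv F z) :=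
    s1.mul_shift (by simp) fun n => by push_cast; ring
  have s4 : HasSum (fun n : ℕ => n * ((n + 1) * c (n + 1)) * z ^ n) (z * deriv (deriv F) z) :=
    s2.mul_shift (by simp) fun n => by push_cast; ring
  have s5 : HasSum (fun n : ℕ => (n * (n - 1)) * c n * z ^ n) (z * (z * deriv (deriv F) z)) :=
    s4.mul_shift (by simp) fun n => by push_cast; ring
  have s6 := ((s4.sub s5).add (s1.sub (s3.mul_left (a + b + 1)))).sub (s0.mul_left (a * b))
  have s7 := s6.unique (hasSum_zero.congr_fun fun n => ?_)
  · linear_combination s7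
  · linear_combination z ^ n * ordinaryHypergeometricCoefficient_succ a b n

/-- An analytic solution of the hypergeometric equation with `c = 1` that vanishes at the origin
vanishes identically. -/
lemma eventually_eq_zero_of_hypergeometric_ode {a b : ℂ} {f : ℂ → ℂ} (hf : AnalyticAt ℂ f 0)
    (h0 : f 0 = 0)
    (hode : ∀ᶠ z in 𝓝 0, z * (1 - z) * deriv (deriv f) z + (1 - (a + b + 1) * z) * deriv f z
      - a * b * f z = 0) : ∀ᶠ z in 𝓝 0, f z = 0 := by
  by_contra hne
  obtain ⟨n, g, hg, hg0, hfg⟩ := hf.exists_eventuallyEq_pow_smul_nonzero_iff.2 hne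
  simp only [sub_zero, smul_eq_mul] at hfg
  obtain _ | m := n
  · exact hg0 (by simpa [h0] using hfg.self_of_nhds.symm)
  have hd1 : deriv f =ᶠ[𝓝 0] fun z => (m + 1) * z ^ m * g z + z ^ (m + 1) * deriv g z := by
    refine (EventuallyEq.deriv hfg).trans ?_
    filter_upwards [hg.eventually_analyticAt] with z hz
    have := ((hasDerivAt_pow (m + 1) z).mul hz.differentiableAt.hasDerivAt).deriv
    refine this.trans ?_
    simp
  have hd2 : ∀ᶠ z in 𝓝 0, z * deriv (deriv f) z = z ^ m *
      ((m + 1) * m * g z + 2 * (m + 1) * z * deriv g z + z ^ 2 * deriv (deriv g) z) := by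
    filter_upwards [EventuallyEq.deriv hd1, hg.eventually_analyticAt] with z h1 hz
    have h2 := ((((hasDerivAt_pow m z).const_mul ((m : ℂ) + 1)).mul
      hz.differentiableAt.hasDerivAt).add
      ((hasDerivAt_pow (m + 1) z).mul hz.deriv.differentiableAt.hasDerivAt)).deriv
    rw [h1]
    refine (congrArg (z * ·) h2).trans ?_
    -- The exponent `m - 1` in the derivative of z^m truncates at `m = 0`.
    cases m with
    | zero => simp; ring
    | succ k => simp; ring
  -- With f = z^(m+1) g, `K` is the left side of the equation divided by z^m. Its value at 0 is the
  -- indicial term (m+1)² g(0).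
  set K : ℂ → ℂ := fun z => (1 - z) * ((m + 1) * m * g z + 2 * (m + 1) * z * deriv g z
    + z ^ 2 * deriv (deriv g) z) + (1 - (a + b + 1) * z) * ((m + 1) * g z + z * deriv g z)
    - a * b * z * g z with hK
  have hKc : ContinuousAt K 0 := by
    have c0 := hg.continuousAt
    have c1 := hg.deriv.continuousAt
    have c2 := hg.deriv.deriv.continuousAt
    fun_prop
  have hK0 : ∀ᶠ z in 𝓝[≠] 0, K z = 0 := by
    filter_upwards [hode.filter_mono nhdsWithin_le_nhds, hd1.filter_mono nhdsWithin_le_nhds,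
      hd2.filter_mono nhdsWithin_le_nhds, hfg.filter_mono nhdsWithin_le_nhds,
      self_mem_nhdsWithin] with z e0 e1 e2 e3 hz
    have : z ^ m * K z = 0 := by
      rw [e1, e3] at e0
      simp only [hK]
      linear_combination e0 - (1 - z) * e2
    exact (mul_eq_zero.1 this).resolve_left (pow_ne_zero _ hz)
  have hlim : K 0 = 0 := tendsto_nhds_unique (hKc.tendsto.mono_left nhdsWithin_le_nhds)
    (tendsto_const_nhds.congr' (hK0.mono fun z hz => hz.symm))
  have hm : ((m : ℂ) + 1) ≠ 0 := by exact_mod_cast m.succ_ne_zero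
  refine hg0 ((mul_eq_zero.1 (?_ : ((m : ℂ) + 1) ^ 2 * g 0 = 0)).resolve_left (pow_ne_zero _ hm))
  simp only [hK] at hlim
  linear_combination hlim

/-- A rational pullback, twisted by a factor with logarithmic derivative `r`, carries one
hypergeometric function to another as soon as it carries one differential equation to the other. -/
lemma hypergeometric_pullback {a b A B : ℂ} (hab : ∀ k : ℕ, (k : ℂ) ≠ -a ∧ (k : ℂ) ≠ -b)
    (hAB : ∀ k : ℕ, (k : ℂ) ≠ -A ∧ (k : ℂ) ≠ -B) {φ φ₁ φ₂ h r r₁ s : ℂ → ℂ}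
    (hφ0 : φ 0 = 0) (hh0 : h 0 = 1)
    (hφ : ∀ᶠ z in 𝓝 0, HasDerivAt φ (φ₁ z) z) (hφ₁ : ∀ᶠ z in 𝓝 0, HasDerivAt φ₁ (φ₂ z) z)
    (hh : ∀ᶠ z in 𝓝 0, HasDerivAt h (r z * h z) z) (hr : ∀ᶠ z in 𝓝 0, HasDerivAt r (r₁ z) z)
    (e₂ : ∀ᶠ z in 𝓝 0, z * (1 - z) * φ₁ z ^ 2 = s z * (φ z * (1 - φ z)))
    (e₁ : ∀ᶠ z in 𝓝 0, z * (1 - z) * (2 * r z * φ₁ z + φ₂ z) + (1 - (A + B + 1) * z) * φ₁ z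
      = s z * (1 - (a + b + 1) * φ z))
    (e₀ : ∀ᶠ z in 𝓝 0, z * (1 - z) * (r z ^ 2 + r₁ z) + (1 - (A + B + 1) * z) * r z - A * B
      = - s z * (a * b)) :
    ∀ᶠ z in 𝓝 0, h z * ordinaryHypergeometric a b 1 (φ z) = ordinaryHypergeometric A B 1 z := by
  set F : ℂ → ℂ := ordinaryHypergeometric a b 1 with hF
  set G : ℂ → ℂ := ordinaryHypergeometric A B 1 with hG
  have hFa := hasFPowerSeriesOnBall_hypergeometric hab
  have hGa := hasFPowerSeriesOnBall_hypergeometric hAB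
  rw [← hF] at hFa
  rw [← hG] at hGa
  have hφc : Tendsto φ (𝓝 0) (𝓝 0) := by
    simpa [hφ0] using hφ.self_of_nhds.continuousAt.tendsto
  have hφball : ∀ᶠ z in 𝓝 0, φ z ∈ Metric.eball (0 : ℂ) 1 :=
    hφc.eventually (Metric.eball_mem_nhds 0 one_pos)
  have hball : ∀ᶠ z in 𝓝 0, z ∈ Metric.eball (0 : ℂ) 1 := Metric.eball_mem_nhds 0 one_pos
  have hd1 : ∀ᶠ z in 𝓝 0, HasDerivAt (fun z => h z * F (φ z))
      (h z * (r z * F (φ z) + φ₁ z * deriv F (φ z))) z := by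
    filter_upwards [hφball, hφ, hh] with z h1 h2 h3
    have hFd := (hFa.analyticAt_of_mem h1).differentiableAt.hasDerivAt
    refine (h3.mul (hFd.comp z h2)).congr_deriv ?_
    simp only [Function.comp]
    ring
  have hd2 : ∀ᶠ z in 𝓝 0, HasDerivAt
      (fun z => h z * (r z * F (φ z) + φ₁ z * deriv F (φ z)))
      (h z * ((r z ^ 2 + r₁ z) * F (φ z) + (2 * r z * φ₁ z + φ₂ z) * deriv F (φ z)
        + φ₁ z ^ 2 * deriv (deriv F) (φ z))) z := by
    filter_upwards [hφball, hφ, hh, hφ₁, hr] with z h1 h2 h3 h4 h5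
    have hFd := (hFa.analyticAt_of_mem h1).differentiableAt.hasDerivAt
    have hFd' := (hFa.analyticAt_of_mem h1).deriv.differentiableAt.hasDerivAt
    refine (h3.mul ((h5.mul (hFd.comp z h2)).add (h4.mul (hFd'.comp z h2)))).congr_deriv ?_
    simp only [Pi.add_apply, Pi.mul_apply, Function.comp]
    ring
  have hGz : ∀ᶠ z in 𝓝 0, AnalyticAt ℂ G z := hball.mono fun z hz => hGa.analyticAt_of_mem hz
  have hE1 : deriv (fun z => h z * F (φ z) - G z) =ᶠ[𝓝 0]
      fun z => h z * (r z * F (φ z) + φ₁ z * deriv F (φ z)) - deriv G z := by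
    filter_upwards [hd1, hGz] with z h1 h2
    exact (h1.sub h2.differentiableAt.hasDerivAt).deriv
  have key : ∀ᶠ z in 𝓝 0, h z * F (φ z) - G z = 0 := by
    refine eventually_eq_zero_of_hypergeometric_ode (a := A) (b := B) ?_ ?_ ?_
    · rw [Complex.analyticAt_iff_eventually_differentiableAt]
      filter_upwards [hd1, hGz] with z h1 h2
      exact h1.differentiableAt.sub h2.differentiableAt
    · simp [hF, hG, hφ0, hh0]
    · filter_upwards [hd2, hGz, hE1, EventuallyEq.deriv hE1, hφball, hball, e₀, e₁, e₂]
        with z h1 h2 h3 h4 h5 h6 k0 k1 k2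
      have h7 := (h1.sub h2.deriv.differentiableAt.hasDerivAt).deriv
      have o1 := hypergeometric_ode hab h5 hF
      have o2 := hypergeometric_ode hAB h6 hG
      rw [h3, h4]
      refine Eq.trans (congrArg (fun t => z * (1 - z) * t + _ - _) h7) ?_
      -- `k2`, `k1`, `k0` match the coefficients of F'', F', F at φ(z) with those of `s z` times the
      -- hypergeometric equation there.
      linear_combination h z * s z * o1 - o2 + h z * deriv (deriv F) (φ z) * k2
        + h z * deriv F (φ z) * k1 + h z * F (φ z) * k0
  exact key.mono fun z hz => sub_eq_zero.1 hz

/-! ### Pfaff, quadratic and cubic transformations -/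

lemma natCast_ne_neg_of_re_pos {a : ℂ} (ha : 0 < a.re) (k : ℕ) : (k : ℂ) ≠ -a := fun h => by
  have h1 := congrArg Complex.re h
  simp only [Complex.natCast_re, Complex.neg_re] at h1
  linarith [k.cast_nonneg (α := ℝ)]

lemma hasDerivAt_one_add_mul (w z : ℂ) : HasDerivAt (fun z => 1 + w * z) w z := by
  simpa using ((hasDerivAt_id z).const_mul w).const_add 1

lemma eventually_hasDerivAt_cpow (w e : ℂ) : ∀ᶠ z : ℂ in 𝓝 0, 1 + w * z ≠ 0 ∧
    HasDerivAt (fun z => (1 + w * z) ^ e) (e * w / (1 + w * z) * (1 + w * z) ^ e) z := by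
  have hc : Tendsto (fun z : ℂ => 1 + w * z) (𝓝 0) (𝓝 1) := by
    have : ContinuousAt (fun z : ℂ => 1 + w * z) 0 := by fun_prop
    simpa using this.tendsto
  filter_upwards [hc.eventually (Complex.isOpen_slitPlane.mem_nhds Complex.one_mem_slitPlane)]
    with z hz
  have hne := Complex.slitPlane_ne_zero hz
  refine ⟨hne, ((hasDerivAt_one_add_mul w z).cpow_const (c := e) hz).congr_deriv ?_⟩
  rw [Complex.cpow_sub _ _ hne, Complex.cpow_one]
  field_simp

lemma hasDerivAt_div_linear (c w : ℂ) {z : ℂ} (hz : 1 + w * z ≠ 0) :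
    HasDerivAt (fun z => c / (1 + w * z)) (-c * w / (1 + w * z) ^ 2) z := by
  refine ((hasDerivAt_const z c).div (hasDerivAt_one_add_mul w z) hz).congr_deriv ?_
  simp

lemma eventually_sub_one_ne_zero : ∀ᶠ z : ℂ in 𝓝 0, z - 1 ≠ 0 := by
  have : ContinuousAt (fun z : ℂ => z - 1) 0 := by fun_prop
  exact this.eventually_ne (by simp)

/-- Pfaff's transformation. -/
lemma hypergeometric_pfaff {a b : ℂ} (ha : 0 < a.re) (hb : 0 < b.re) (hb' : 0 < (1 - b).re) :
    ∀ᶠ z : ℂ in 𝓝 0, (1 + -1 * z) ^ (-a) * hypF a b 1 (z / (z - 1))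
      = hypF a (1 - b) 1 z := by
  refine hypergeometric_pullback
    (φ₁ := fun z => -1 / (z - 1) ^ 2) (φ₂ := fun z => 2 / (z - 1) ^ 3)
    (r := fun z => -a * -1 / (1 + -1 * z)) (r₁ := fun z => -(-a * -1) * -1 / (1 + -1 * z) ^ 2)
    -- The condition on φ₁² forces s = z(1-z)φ₁²/(φ(1-φ)).
    (s := fun z => 1 / (z - 1))
    (fun k => ⟨natCast_ne_neg_of_re_pos ha k, natCast_ne_neg_of_re_pos hb k⟩)
    (fun k => ⟨natCast_ne_neg_of_re_pos ha k, natCast_ne_neg_of_re_pos hb' k⟩)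
    (by simp) (by simp) ?_ ?_ ((eventually_hasDerivAt_cpow _ _).mono fun z h => h.2)
    ((eventually_hasDerivAt_cpow (-1) 1).mono fun z h => hasDerivAt_div_linear _ _ h.1) ?_ ?_ ?_
  all_goals filter_upwards [eventually_sub_one_ne_zero] with z hz
  · have h1 : HasDerivAt (fun z : ℂ => z - 1) 1 z := (hasDerivAt_id z).sub_const 1
    refine ((hasDerivAt_id z).div h1 hz).congr_deriv ?_
    simp
  · have h1 : HasDerivAt (fun z : ℂ => z - 1) 1 z := (hasDerivAt_id z).sub_const 1
    refine ((hasDerivAt_const z (-1 : ℂ)).div (h1.pow 2) (pow_ne_zero 2 hz)).congr_deriv ?_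
    simp
    field_simp
  all_goals have hz' : (1 : ℂ) + -1 * z = -(z - 1) := by ring
  all_goals try simp only [hz']
  all_goals field_simp
  all_goals ring

/-- A quadratic transformation. -/
lemma hypergeometric_quadratic : ∀ᶠ z : ℂ in 𝓝 0, (1 + -1 * z) ^ (-(1 / 12) : ℂ) *
    hypF (1 / 12) (5 / 12) 1 (z ^ 2 / (4 * (z - 1)))
      = hypF (1 / 6) (1 / 2) 1 z := by
  refine hypergeometric_pullback
    (φ₁ := fun z => z * (z - 2) / (4 * (z - 1) ^ 2)) (φ₂ := fun z => 1 / (2 * (z - 1) ^ 3))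
    (r := fun z => -(1 / 12) * -1 / (1 + -1 * z))
    (r₁ := fun z => -(-(1 / 12) * -1) * -1 / (1 + -1 * z) ^ 2)
    (s := fun z => z / (z - 1))
    (fun k => ⟨natCast_ne_neg_of_re_pos (by norm_num) k, natCast_ne_neg_of_re_pos (by norm_num) k⟩)
    (fun k => ⟨natCast_ne_neg_of_re_pos (by norm_num) k, natCast_ne_neg_of_re_pos (by norm_num) k⟩)
    (by simp) (by simp) ?_ ?_ ((eventually_hasDerivAt_cpow _ _).mono fun z h => h.2)
    ((eventually_hasDerivAt_cpow (-1) 1).mono fun z h => hasDerivAt_div_linear _ _ h.1) ?_ ?_ ?_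
  all_goals filter_upwards [eventually_sub_one_ne_zero] with z hz
  · have h1 : HasDerivAt (fun z : ℂ => z - 1) 1 z := (hasDerivAt_id z).sub_const 1
    refine ((hasDerivAt_pow 2 z).div (h1.const_mul (4 : ℂ)) (mul_ne_zero (by norm_num : (4 : ℂ) ≠ 0) hz)).congr_deriv ?_
    simp
    field_simp
    ring
  · have h1 : HasDerivAt (fun z : ℂ => z - 1) 1 z := (hasDerivAt_id z).sub_const 1
    have h2 : HasDerivAt (fun z : ℂ => z - 2) 1 z := (hasDerivAt_id z).sub_const 2
    refine (((hasDerivAt_id z).mul h2).div ((h1.pow 2).const_mul (4 : ℂ))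
      (mul_ne_zero (by norm_num : (4 : ℂ) ≠ 0) (pow_ne_zero 2 hz))).congr_deriv ?_
    simp
    field_simp
    ring
  all_goals have hz' : (1 : ℂ) + -1 * z = -(z - 1) := by ring
  all_goals try simp only [hz']
  all_goals field_simp
  all_goals ring

/-- A cubic transformation; `w` is a primitive cube root of unity. -/
lemma hypergeometric_cubic {w : ℂ} (hw : w ^ 2 + w + 1 = 0) :
    ∀ᶠ z : ℂ in 𝓝 0, (1 + w * z) ^ (-(1 / 2) : ℂ) *
      hypF (1 / 6) (1 / 2) 1 (3 * (2 * w + 1) * z * (1 - z) / (1 + w * z) ^ 3)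
      = hypF (1 / 2) (1 / 2) 1 z := by
  refine hypergeometric_pullback
    -- Here 1 - φ = ((1+w²z)/(1+wz))³, so φ is triply ramified over 1 and ∞, where the exponent
    -- differences of F(1/6,1/2,1) are 1/3. Only the points 0, 1, ∞ above 0 remain singular.
    (φ₁ := fun z => 3 * (2 * w + 1) * (1 + w ^ 2 * z) ^ 2 / (1 + w * z) ^ 4)
    (φ₂ := fun z => 3 * (2 * w + 1) * (1 + w ^ 2 * z) *
      (2 * w ^ 2 * (1 + w * z) - 4 * w * (1 + w ^ 2 * z)) / (1 + w * z) ^ 5)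
    (r := fun z => -(1 / 2) * w / (1 + w * z))
    (r₁ := fun z => -(-(1 / 2) * w) * w / (1 + w * z) ^ 2)
    (s := fun z => 3 * (2 * w + 1) * (1 + w ^ 2 * z) / (1 + w * z) ^ 2)
    (fun k => ⟨natCast_ne_neg_of_re_pos (by norm_num) k, natCast_ne_neg_of_re_pos (by norm_num) k⟩)
    (fun k => ⟨natCast_ne_neg_of_re_pos (by norm_num) k, natCast_ne_neg_of_re_pos (by norm_num) k⟩)
    (by simp) (by simp) ?_ ?_ ((eventually_hasDerivAt_cpow _ _).mono fun z h => h.2)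
    ((eventually_hasDerivAt_cpow w 1).mono fun z h => hasDerivAt_div_linear _ _ h.1) ?_ ?_ ?_
  all_goals filter_upwards [(eventually_hasDerivAt_cpow w 1)] with z hz
  all_goals replace hz := hz.1
  all_goals have hz' : 1 + z * w ≠ 0 := by rwa [mul_comm]
  · have h1 := hasDerivAt_one_add_mul w z
    have h2 : HasDerivAt (fun z : ℂ => 1 - z) (-1) z := (hasDerivAt_id z).const_sub 1
    refine (((((hasDerivAt_id z).const_mul (3 * (2 * w + 1))).mul h2)).div (h1.pow 3)
      (pow_ne_zero 3 hz)).congr_deriv ?_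
    simp
    field_simp
    grind
  · have h1 := hasDerivAt_one_add_mul w z
    have h2 := hasDerivAt_one_add_mul (w ^ 2) z
    refine ((((h2.pow 2).const_mul (3 * (2 * w + 1)))).div (h1.pow 4) (pow_ne_zero 4 hz)).congr_deriv ?_
    simp
    field_simp
  all_goals field_simp
  all_goals grind

/-! ### Squared forms without fractional powers -/

lemma cpow_neg_half_sq_mul {u : ℂ} (hu : u ≠ 0) : (u ^ (-(1 / 2) : ℂ)) ^ 2 * u = 1 := by
  rw [← Complex.cpow_nat_mul, show ((2 : ℕ) : ℂ) * -(1 / 2) = -1 by norm_num,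
    Complex.cpow_neg_one, inv_mul_cancel₀ hu]

lemma omegaCube_quadratic : omegaCube ^ 2 + omegaCube + 1 = 0 := by
  have h3 : ((Real.sqrt 3 : ℝ) : ℂ) ^ 2 = 3 := by
    rw [← Complex.ofReal_pow, Real.sq_sqrt (by norm_num)]; norm_num
  unfold omegaCube
  linear_combination (1 / 4 : ℂ) * (Complex.I ^ 2 * h3 + 3 * Complex.I_sq)

lemma hypF_half_half_sq : ∀ᶠ z : ℂ in 𝓝 0,
    hypF (1 / 2) (1 / 2) 1 (z / (z - 1)) ^ 2 = (1 - z) * hypF (1 / 2) (1 / 2) 1 z ^ 2 := by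
  filter_upwards [hypergeometric_pfaff (a := 1 / 2) (b := 1 / 2) (by norm_num) (by norm_num)
    (by norm_num), (eventually_hasDerivAt_cpow (-1) 1)] with z h hz
  rw [show (1 - 1 / 2 : ℂ) = 1 / 2 by norm_num] at h
  rw [← h]
  linear_combination -(hypF (1 / 2) (1 / 2) 1 (z / (z - 1))) ^ 2 * cpow_neg_half_sq_mul hz.1

lemma hypF_cubic_sq {w : ℂ} (hw : w ^ 2 + w + 1 = 0) : ∀ᶠ z : ℂ in 𝓝 0,
    hypF (1 / 6) (1 / 2) 1 (3 * (2 * w + 1) * z * (1 - z) / (1 + w * z) ^ 3) ^ 2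
      = (1 + w * z) * hypF (1 / 2) (1 / 2) 1 z ^ 2 := by
  filter_upwards [hypergeometric_cubic hw, (eventually_hasDerivAt_cpow w 1)] with z h hz
  rw [← h]
  linear_combination -(hypF (1 / 6) (1 / 2) 1
    (3 * (2 * w + 1) * z * (1 - z) / (1 + w * z) ^ 3)) ^ 2 * cpow_neg_half_sq_mul hz.1

lemma hypF_quadratic_sq : ∀ᶠ z : ℂ in 𝓝 0,
    hypF (1 / 12) (5 / 12) 1 (z ^ 2 / (4 * (z - 1))) ^ 2
      = hypF (1 / 6) (1 / 2) 1 z * hypF (1 / 6) (1 / 2) 1 (z / (z - 1)) := by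
  filter_upwards [hypergeometric_pfaff (a := 1 / 6) (b := 1 / 2) (by norm_num) (by norm_num)
    (by norm_num), hypergeometric_quadratic, (eventually_hasDerivAt_cpow (-1) 1)] with z h h' hz
  rw [show (1 - 1 / 2 : ℂ) = 1 / 2 by norm_num] at h
  have h1 : ((1 + -1 * z) ^ (-(1 / 12) : ℂ)) ^ 2 = (1 + -1 * z) ^ (-(1 / 6) : ℂ) := by
    rw [← Complex.cpow_nat_mul]
    norm_num
  have h2 : (1 + -1 * z) ^ (-(1 / 6) : ℂ) ≠ 0 := by 
    rw [Ne, Complex.cpow_eq_zero_iff]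
    exact fun hc => hz.1 hc.1
  -- The squared quadratic factor (1-z)^(-1/6) is exactly Pfaff's factor for a = 1/6.
  refine mul_left_cancel₀ h2 ?_
  calc _ = hypF (1 / 6) (1 / 2) 1 z ^ 2 := by rw [← h', mul_pow, h1]
    _ = _ := by
      rw [sq]
      nth_rewrite 2 [← h]
      ring

theorem mainTheorem5 :
    ∀ᶠ z : ℂ in nhds 0,
      (hypF (1 / 6) (1 / 2) 1
          (3 * (Real.sqrt 3 : ℂ) * Complex.I * z * (1 - z) / (1 + omegaCube * z) ^ 3) ^ 2
        = -omegaCube ^ 2 * hypF (1 / 2) (1 / 2) 1 z ^ 2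
          - omegaCube * hypF (1 / 2) (1 / 2) 1 (z / (z - 1)) ^ 2) ∧
      (hypF (1 / 6) (1 / 2) 1
          (-(3 * (Real.sqrt 3 : ℂ) * Complex.I * z * (1 - z) / (z + omegaCube) ^ 3)) ^ 2
        = -omegaCube * hypF (1 / 2) (1 / 2) 1 z ^ 2
          - omegaCube ^ 2 * hypF (1 / 2) (1 / 2) 1 (z / (z - 1)) ^ 2) ∧
      (hypF (1 / 12) (5 / 12) 1 (z ^ 2 / (4 * (z - 1))) ^ 2
        = hypF (1 / 6) (1 / 2) 1 z * hypF (1 / 6) (1 / 2) 1 (z / (z - 1))) ∧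
      (hypF (1 / 12) (5 / 12) 1
          (27 * z ^ 2 * (1 - z) ^ 2 / (4 * (z ^ 2 - z + 1) ^ 3)) ^ 4
        = hypF (1 / 2) (1 / 2) 1 z ^ 4 + hypF (1 / 2) (1 / 2) 1 (z / (z - 1)) ^ 4
          - hypF (1 / 2) (1 / 2) 1 z ^ 2 * hypF (1 / 2) (1 / 2) 1 (z / (z - 1)) ^ 2) := by
  have hw := omegaCube_quadratic
  have hs : 2 * omegaCube + 1 = (Real.sqrt 3 : ℂ) * Complex.I := by unfold omegaCube; ring
  set w := omegaCube
  have hw' : (w ^ 2) ^ 2 + w ^ 2 + 1 = 0 := by linear_combination (w ^ 2 - w + 1) * hw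
  have hX : Tendsto (fun z : ℂ => 3 * (2 * w + 1) * z * (1 - z) / (1 + w * z) ^ 3) (𝓝 0) (𝓝 0) := by
    have : ContinuousAt (fun z : ℂ => 3 * (2 * w + 1) * z * (1 - z) / (1 + w * z) ^ 3) 0 :=
      ContinuousAt.div (by fun_prop) (by fun_prop) (by simp)
    simpa using this.tendsto
  filter_upwards [hypF_half_half_sq, hypF_cubic_sq hw, hypF_cubic_sq hw', hypF_quadratic_sq,
    hX.eventually hypF_quadratic_sq, eventually_hasDerivAt_cpow w 1,
    eventually_hasDerivAt_cpow (w ^ 2) 1] with z p c₁ c₂ q qX hz₁ hz₂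
  replace hz₁ := hz₁.1
  replace hz₂ := hz₂.1
  have hz₁' : 1 + z * w ≠ 0 := by rwa [mul_comm]
  have hz₂' : 1 + z * w ^ 2 ≠ 0 := by rwa [mul_comm]
  set X := 3 * (2 * w + 1) * z * (1 - z) / (1 + w * z) ^ 3 with hXd
  set Y := 3 * (2 * w ^ 2 + 1) * z * (1 - z) / (1 + w ^ 2 * z) ^ 3 with hYd
  have hw0 : w ≠ 0 := fun h => by simp [h] at hw
  have hzw : z + w = w * (1 + w ^ 2 * z) := by linear_combination -(w - 1) * z * hw
  have e1 : 3 * (Real.sqrt 3 : ℂ) * Complex.I * z * (1 - z) / (1 + w * z) ^ 3 = X := by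
    rw [hXd, hs]; ring
  have e2 : -(3 * (Real.sqrt 3 : ℂ) * Complex.I * z * (1 - z) / (z + w) ^ 3) = Y := by
    rw [hYd, hzw, mul_assoc 3, ← hs]
    field_simp
    grind
  have hX1 : X - 1 = -((1 + w ^ 2 * z) ^ 3 / (1 + w * z) ^ 3) := by
    rw [hXd]
    field_simp
    grind
  -- Pfaff's involution carries the cubic argument for ω to the one for ω², so the third equation at
  -- `X` involves only the values known from `c₁` and `c₂`.
  have e3 : X / (X - 1) = Y := by
    rw [hX1, hXd, hYd]
    field_simp
    grind
  have e4 : X ^ 2 / (4 * (X - 1)) = 27 * z ^ 2 * (1 - z) ^ 2 / (4 * (z ^ 2 - z + 1) ^ 3) := by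
    rw [hX1, hXd, show z ^ 2 - z + 1 = (1 + w * z) * (1 + w ^ 2 * z) by
      linear_combination (- z - (w - 1) * z ^ 2) * hw]
    field_simp
    grind
  rw [e3, e4] at qX
  rw [e1, e2]
  refine ⟨?_, ?_, q, ?_⟩
  · rw [c₁, p]
    linear_combination hypF (1 / 2) (1 / 2) 1 z ^ 2 * hw
  · rw [c₂, p]
    linear_combination hypF (1 / 2) (1 / 2) 1 z ^ 2 * hw
  · set F := hypF (1 / 2) (1 / 2) 1 z
    set P := hypF (1 / 2) (1 / 2) 1 (z / (z - 1))
    set E := hypF (1 / 12) (5 / 12) 1 (27 * z ^ 2 * (1 - z) ^ 2 / (4 * (z ^ 2 - z + 1) ^ 3))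
    have hE : E ^ 4 = (1 + w * z) * F ^ 2 * ((1 + w ^ 2 * z) * F ^ 2) := by
      rw [← c₁, ← c₂, ← mul_pow, ← qX]
      ring
    rw [hE]
    -- Since P² = (1-z)F², both sides equal (1 - z + z²)F⁴.
    linear_combination (z + (w - 1) * z ^ 2) * F ^ 4 * hw + (F ^ 2 - P ^ 2 - (1 - z) * F ^ 2) * p
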